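/- **Setting.** Let $p_1,\dots,p_I>0$ with $\sum_i p_i=1$, and write $\mathbb E[\lambda]=\sum_i p_i\lambda_i$. Let $R$ map each $u=(u_1,\dots,u_I)\in(\mathbb R^J)^I$ to a set $R(u)\subseteq\mathbb R^J$ with $R(u)\notin\{\emptyset,\mathbb R^J\}$, such that: $u\le v$ componentwise implies $R(u)\supseteq R(v)$; $R(u+z)=R(u)+z$ for deterministic $z\in\mathbb R^J$; $R(tu+(1-t)v)\supseteq tR(u)+(1-t)R(v)$ for $t\in(0,1)$; and $\mathcal A=\{u\mid 0\in R(u)\}$ is closed (a multivariate convex risk measure). Let $A\in\mathbb R^{K\times M}$, $b\in\mathbb R^K$, $C\in\mathbb R^{J\times M}$, $T_i\in\mathbb R^{L\times M}$, $W_i\in\mathbb R^{L\times N}$, $h_i\in\mathbb R^L$, $Q_i\in\mathbb R^{J\times N}$ ($i=1,\dots,I$), and assume that $$\mathcal X=\{(x,y)\in\mathbb R^M_+\times(\mathbb R^N_+)^I\mid Ax=b,\ T_ix+W_iy_i=h_i\ \forall i\}$$ is compact and nonempty. Put $\mathcal F_i=\{(x_i,y_i)\in\mathbb R^M_+\times\mathbb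 R^N_+\mid Ax_i=b,\ T_ix_i+W_iy_i=h_i\}$ and $Cx+Qy=(Cx+Q_iy_i)_{i}$. For $v\in\mathbb R^J$ let $$\mathscr P_2(v)=\inf\{\alpha\in\mathbb R\mid v+\alpha\mathbf 1\in R(Cx+Qy),\ (x,y)\in\mathcal X\},$$ and let the Lagrangian dual $(LD_2(v))$ be the maximization over $\gamma\in\mathbb R^J_+$ of $$\Lambda_v(\gamma)=\inf_{(x,y)\in\mathcal X,\ \alpha\in\mathbb R}\Big(\alpha+\inf_{z\in R(Cx+Qy)-v-\alpha\mathbf 1}\gamma^{\mathsf T}z\Big).$$ For $m\in(\mathbb R^J_+)^I$ and $\lambda\in(\mathbb R^M)^I$ put $$\tilde\beta(m)=\sup_{u\in\mathcal A}\sum_i m_i^{\mathsf T}u_i,\qquad \tilde f_i(m_i,\lambda_i)=\inf_{(x_i,y_i)\in\mathcal F_i}\big(m_i^{\mathsf T}(Cx_i+Q_iy_i)+p_i\lambda_i^{\mathsf T}x_i\big),$$ $$F(m,\lambda)=\sum_i\tilde f_i(m_i,\lambda_i)-\tilde\beta(m)-\sum_i m_i^{\mathsf T}v .$$ Call $(m,\lambda)$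 *dual feasible* if $m\in(\mathbb R^J_+)^I$, $\sum_i m_i^{\mathsf T}\mathbf 1=1$ and $\mathbb E[\lambda]=0$. **The dual bundle method.** Fix $\varrho>0$, $\kappa\in(0,1)$ and a dual feasible starting point $(m^{(1)},\lambda^{(1)})$. Iteration $k=1,2,\dots$ does the following. 1. For each $i$, let $(x_i^{(k)},y_i^{(k)})$ be a minimizer in the definition of $\tilde f_i(m_i^{(k)},\lambda_i^{(k)})$. Let $\tilde\beta(m^{(k)})<\infty$ and let $\rho^{(k)}$ be a subgradient of the concave function $-\tilde\beta$ at $m^{(k)}$, i.e. $-\tilde\beta(m)\le-\tilde\beta(m^{(k)})+\sum_i(\rho_i^{(k)})^{\mathsf T}(m_i-m_i^{(k)})$ for all $m\in(\mathbb R^J_+)^I$. 2. Call $k$ a *descent iteration* if $k=1$, or if $k\ge2$ and $F(m^{(k)},\lambda^{(k)})\ge(1-\kappa)F(\bar m^{(k-1)},\bar\lambda^{(k-1)})+\kappa\,\Theta^{(k)}$, where $\Theta^{(k)}=\sum_i\vartheta_i^{(k)}+\eta^{(k)}-\sum_i(m_i^{(k)})^{\mathsf T}v$ for $k\ge2$ and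 $\Theta^{(1)}=+\infty$. Put $(\bar m^{(k)},\bar\lambda^{(k)})=(m^{(k)},\lambda^{(k)})$ if $k$ is a descent iteration, and $(\bar m^{(k)},\bar\lambda^{(k)})=(\bar m^{(k-1)},\bar\lambda^{(k-1)})$ otherwise. 3. Let $\mathcal L_k$ be a nonempty subset of $\{1,\dots,k\}$ which contains $k$ if $F(m^{(k)},\lambda^{(k)})<\Theta^{(k)}$ (for example $\mathcal L_k=\{1,\dots,k\}$), and let $(m^{(k+1)},\lambda^{(k+1)},\vartheta^{(k+1)},\eta^{(k+1)})$ be an optimal solution of the master problem $(MP_2(v))$: maximize $$\sum_i\vartheta_i+\eta-\sum_i m_i^{\mathsf T}v-\varrho\sum_i\|m_i-\bar m_i^{(k)}\|^2-\varrho\sum_i\|\lambda_i-\bar\lambda_i^{(k)}\|^2$$ over dual feasible $(m,\lambda)$, $\vartheta\in\mathbb R^I$ and $\eta\in\mathbb R$, subject to, for all $\ell\in\mathcal L_k$ and all $i$, $$\vartheta_i\le\tilde f_i(m_i^{(\ell)},\lambda_i^{(\ell)})+(Cx_i^{(\ell)}+Q_iy_i^{(\ell)})^{\mathsf T}(m_i-m_i^{(\ell)})+p_i(x_i^{(\ell)})^{\mathsf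 T}(\lambda_i-\lambda_i^{(\ell)}),$$ $$\eta\le-\tilde\beta(m^{(\ell)})+\sum_i(\rho_i^{(\ell)})^{\mathsf T}(m_i-m_i^{(\ell)}).$$ For $\varepsilon>0$, let $k$ be the first iteration with $\Theta^{(k+1)}-F(\bar m^{(k)},\bar\lambda^{(k)})\le\varepsilon$ (approximate stopping condition), let $n+1$ be the first descent iteration after $k$ when the method is continued, and set $$\gamma_{(v)}=\sum_i m_i^{(n+1)} .$$ **Theorem.** $\mathscr P_2(v)$ is finite, $\gamma_{(v)}\in\mathbb R^J_+$, and $\gamma_{(v)}$ is an approximately optimal solution of $(LD_2(v))$ in the sense that $$\big|\Lambda_v(\gamma_{(v)})-\mathscr P_2(v)\big|\to0\quad\text{as }\varepsilon\to0 .$$ That is, for every $\delta>0$ there is $\varepsilon_0>0$, depending only on $\delta$, the problem data, $v$, $\varrho$, $\kappa$ and $(m^{(1)},\lambda^{(1)})$, such that for all $\varepsilon\in(0,\varepsilon_0)$ and every run of the method from $(m^{(1)},\lambda^{(1)})$ in which $k$ and $n+1$ exist, $\Lambda_v(\gamma_{(v)})$ is finite and $|\Lambda_v(\gamma_{(v)})-\mathscr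 P_2(v)|<\delta$. -/

import Mathlib

open scoped Matrix Pointwise

/-- A multivariate convex risk measure on a finite probability space with `I` scenarios:
a set-valued map on `J`-dimensional random cost vectors `u`, where `u i` is the realization
of `u` in scenario `i`. -/
structure ConvexRiskMeasure (I J : ℕ) where
  /-- the set of deterministic vectors that make `u` acceptable -/
  toFun : (Fin I → Fin J → ℝ) → Set (Fin J → ℝ)
  monotone : ∀ u v, u ≤ v → toFun v ⊆ toFun u
  translative : ∀ u (z : Fin J → ℝ), toFun (fun i => u i + z) = toFun u + {z}
  nonempty : ∀ u, toFun u ≠ ∅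
  ne_univ : ∀ u, toFun u ≠ Set.univ
  convex : ∀ u v (t : ℝ), 0 < t → t < 1 →
    t • toFun u + (1 - t) • toFun v ⊆ toFun (t • u + (1 - t) • v)
  closed : IsClosed {u | (0 : Fin J → ℝ) ∈ toFun u}

/-- The acceptance set of a risk measure. -/
def ConvexRiskMeasure.acceptance {I J : ℕ} (R : ConvexRiskMeasure I J) :
    Set (Fin I → Fin J → ℝ) :=
  {u | (0 : Fin J → ℝ) ∈ R.toFun u}

/-- The data of a two-stage multi-objective risk-averse stochastic linear program with
`I` scenarios, `J` objectives, `K` first-stage and `L` second-stage constraints, and decision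
vectors of dimension `M` (first stage) and `N` (second stage). -/
structure TwoStageProblem (I J K L M N : ℕ) where
  /-- scenario probabilities -/
  p : Fin I → ℝ
  p_pos : ∀ i, 0 < p i
  p_sum : ∑ i, p i = 1
  R : ConvexRiskMeasure I J
  A : Matrix (Fin K) (Fin M) ℝ
  b : Fin K → ℝ
  C : Matrix (Fin J) (Fin M) ℝ
  T : Fin I → Matrix (Fin L) (Fin M) ℝ
  W : Fin I → Matrix (Fin L) (Fin N) ℝ
  h : Fin I → Fin L → ℝ
  Q : Fin I → Matrix (Fin J) (Fin N) ℝ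

/-- A point `(m, λ, ϑ, η)` of the space of variables of the master problem. -/
structure MasterPoint (I J M : ℕ) where
  m : Fin I → Fin J → ℝ
  lam : Fin I → Fin M → ℝ
  theta : Fin I → ℝ
  eta : ℝ

/-- The linear part `∑ᵢ ϑᵢ + η - ∑ᵢ mᵢᵀ v` of the objective of the master problem. -/
def MasterPoint.model {I J M : ℕ} (P : MasterPoint I J M) (v : Fin J → ℝ) : ℝ :=
  ∑ i, P.theta i + P.eta - ∑ i, P.m i ⬝ᵥ v

/-- Everything that the dual bundle method computes; the index is the iteration counter, which
starts at `1`. -/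
structure BundleIterates (I J M N : ℕ) where
  /-- trial points; `theta` and `eta` of the first one stand for `+∞` and are never read -/
  pt : ℕ → MasterPoint I J M
  /-- solutions of the scenario subproblems -/
  x : ℕ → Fin I → Fin M → ℝ
  y : ℕ → Fin I → Fin N → ℝ
  /-- subgradients of the negative penalty function -/
  rho : ℕ → Fin I → Fin J → ℝ
  /-- index set of the cuts in the master problem of each iteration -/
  cuts : ℕ → Finset ℕ
  /-- centers -/
  mbar : ℕ → Fin I → Fin J → ℝ
  lambar : ℕ → Fin I → Fin M → ℝ

/-- The objective function of the master problem of iteration `k`, with regularization parameter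
`rg`; `d ⬝ᵥ d` is the square of the Euclidean norm of `d`. -/
def BundleIterates.masterObjective {I J M N : ℕ} (s : BundleIterates I J M N) (v : Fin J → ℝ)
    (rg : ℝ) (k : ℕ) (P : MasterPoint I J M) : ℝ :=
  P.model v - ∑ i, rg * ((P.m i - s.mbar k i) ⬝ᵥ (P.m i - s.mbar k i))
    - ∑ i, rg * ((P.lam i - s.lambar k i) ⬝ᵥ (P.lam i - s.lambar k i))

namespace TwoStageProblem

variable {I J K L M N : ℕ} (D : TwoStageProblem I J K L M N)

/-- The feasible set of the decision pairs `(x, y)`, with `x` deterministic. -/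
def feasible : Set ((Fin M → ℝ) × (Fin I → Fin N → ℝ)) :=
  {q | 0 ≤ q.1 ∧ 0 ≤ q.2 ∧ D.A *ᵥ q.1 = D.b ∧ ∀ i, D.T i *ᵥ q.1 + D.W i *ᵥ q.2 i = D.h i}

/-- The feasible set of scenario `i`. -/
def scenarioFeasible (i : Fin I) : Set ((Fin M → ℝ) × (Fin N → ℝ)) :=
  {q | 0 ≤ q.1 ∧ 0 ≤ q.2 ∧ D.A *ᵥ q.1 = D.b ∧ D.T i *ᵥ q.1 + D.W i *ᵥ q.2 = D.h i}

/-- The random cost vector `Cx + Qy`. -/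
def cost (q : (Fin M → ℝ) × (Fin I → Fin N → ℝ)) : Fin I → Fin J → ℝ :=
  fun i => D.C *ᵥ q.1 + D.Q i *ᵥ q.2 i

/-- The optimal value of the scalarization by the reference variable `v`: the infimum of all
`α` such that `v + α 1 ∈ R(Cx + Qy)` for some feasible `(x, y)`. -/
noncomputable def refValue (v : Fin J → ℝ) : EReal :=
  ⨅ q ∈ D.feasible, ⨅ α : ℝ, ⨅ _ : (v + fun _ => α) ∈ D.R.toFun (D.cost q), (α : EReal)

/-- The objective function of the Lagrangian dual of the scalarization by `v`. -/
noncomputable def lagrangeDual (v γ : Fin J → ℝ) : EReal :=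
  ⨅ q ∈ D.feasible, ⨅ α : ℝ,
    ((α : EReal) + ⨅ z ∈ D.R.toFun (D.cost q) - {v + fun _ => α}, ((γ ⬝ᵥ z : ℝ) : EReal))

/-- The minimal penalty function, as a function of a vector `m` of finite measures. -/
noncomputable def penalty (m : Fin I → Fin J → ℝ) : EReal :=
  ⨆ u ∈ D.R.acceptance, ((∑ i, m i ⬝ᵥ u i : ℝ) : EReal)

/-- The objective function of the subproblem of scenario `i`. -/
def scenarioObjective (i : Fin I) (mi : Fin J → ℝ) (lami : Fin M → ℝ)
    (q : (Fin M → ℝ) × (Fin N → ℝ)) : ℝ :=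
  mi ⬝ᵥ (D.C *ᵥ q.1 + D.Q i *ᵥ q.2) + D.p i * (lami ⬝ᵥ q.1)

/-- The optimal value of the subproblem of scenario `i`. -/
noncomputable def scenarioValue (i : Fin I) (mi : Fin J → ℝ) (lami : Fin M → ℝ) : EReal :=
  ⨅ q ∈ D.scenarioFeasible i, ((D.scenarioObjective i mi lami q : ℝ) : EReal)

/-- The objective function of the decomposed dual problem. No sum `⊤ + ⊥` occurs as soon as
all scenario feasible sets are nonempty, because `penalty` is never `⊥`. -/
noncomputable def dualObjective (v : Fin J → ℝ) (m : Fin I → Fin J → ℝ)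
    (lam : Fin I → Fin M → ℝ) : EReal :=
  (∑ i, D.scenarioValue i (m i) (lam i)) - D.penalty m - ((∑ i, m i ⬝ᵥ v : ℝ) : EReal)

/-- `rho` is a subgradient, at the vector of finite measures `m₀`, of the concave function
`m ↦ -penalty m` on the set of all vectors of finite measures. -/
def IsPenaltySubgradient (rho m₀ : Fin I → Fin J → ℝ) : Prop :=
  D.penalty m₀ ≠ ⊤ ∧ ∀ m : Fin I → Fin J → ℝ, 0 ≤ m →
    -D.penalty m ≤ -D.penalty m₀ + ((∑ i, rho i ⬝ᵥ (m i - m₀ i) : ℝ) : EReal)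

/-- The constraints that `m` and `λ` have to satisfy, both in the decomposed dual problem and in
the master problem. -/
def IsDualFeasible (m : Fin I → Fin J → ℝ) (lam : Fin I → Fin M → ℝ) : Prop :=
  ∑ i, D.p i • lam i = 0 ∧ ∑ i, ∑ j, m i j = 1 ∧ 0 ≤ m

/-- Feasibility of `P` for the master problem of iteration `k`. The subgradient of the value of
the scenario subproblem in the cut `l` is `(C xᵢ + Qᵢ yᵢ, pᵢ xᵢ)`, with `(xᵢ, yᵢ)` the solution
of the subproblem in iteration `l`. -/
def IsMasterFeasible (s : BundleIterates I J M N) (k : ℕ) (P : MasterPoint I J M) : Prop :=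
  (∀ i, ∀ l ∈ s.cuts k, (P.theta i : EReal) ≤
    D.scenarioValue i ((s.pt l).m i) ((s.pt l).lam i) +
      (((D.C *ᵥ s.x l i + D.Q i *ᵥ s.y l i) ⬝ᵥ (P.m i - (s.pt l).m i) +
        (D.p i • s.x l i) ⬝ᵥ (P.lam i - (s.pt l).lam i) : ℝ) : EReal)) ∧
  (∀ l ∈ s.cuts k, (P.eta : EReal) ≤
    -D.penalty (s.pt l).m + ((∑ i, s.rho l i ⬝ᵥ (P.m i - (s.pt l).m i) : ℝ) : EReal)) ∧
  D.IsDualFeasible P.m P.lam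

/-- `P` is an optimal solution of the master problem of iteration `k`. -/
def IsMasterOptimal (v : Fin J → ℝ) (rg : ℝ) (s : BundleIterates I J M N) (k : ℕ)
    (P : MasterPoint I J M) : Prop :=
  D.IsMasterFeasible s k P ∧
    ∀ P', D.IsMasterFeasible s k P' → s.masterObjective v rg k P' ≤ s.masterObjective v rg k P

/-- Iteration `k` is a descent iteration: `k = 1`, or the dual objective value at the `k`-th trial
point is at least `(1 - κ) F̄ + κ (∑ᵢ ϑᵢ + η - ∑ᵢ mᵢᵀ v)`, where `F̄` is its value at the current
center. -/
def IsDescent (v : Fin J → ℝ) (κ : ℝ) (s : BundleIterates I J M N) (k : ℕ) : Prop :=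
  k = 1 ∨ (2 ≤ k ∧
    ((1 - κ : ℝ) : EReal) * D.dualObjective v (s.mbar (k - 1)) (s.lambar (k - 1)) +
      ((κ * (s.pt k).model v : ℝ) : EReal) ≤ D.dualObjective v (s.pt k).m (s.pt k).lam)

/-- The approximate stopping condition with tolerance `ε` at the end of iteration `k`. -/
def StopsAt (v : Fin J → ℝ) (ε : ℝ) (s : BundleIterates I J M N) (k : ℕ) : Prop :=
  ((s.pt (k + 1)).model v : EReal) ≤ D.dualObjective v (s.mbar k) (s.lambar k) + (ε : EReal)

/-- `s` records the iterations `1, …, n` of a run of the dual bundle method with reference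
variable `v`, regularization parameter `rg` and descent parameter `κ`. The cut of iteration `k`
has to be added whenever it is not already implied at the trial point; apart from that the index
set of the cuts may be any nonempty subset of `{1, …, k}`, in particular `{1, …, k}` itself. -/
structure IsRun (v : Fin J → ℝ) (rg κ : ℝ) (s : BundleIterates I J M N) (n : ℕ) : Prop where
  init : D.IsDualFeasible (s.pt 1).m (s.pt 1).lam
  subproblem_mem : ∀ k, 1 ≤ k → k ≤ n → ∀ i, (s.x k i, s.y k i) ∈ D.scenarioFeasible i
  subproblem_min : ∀ k, 1 ≤ k → k ≤ n → ∀ i,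
    IsMinOn (D.scenarioObjective i ((s.pt k).m i) ((s.pt k).lam i)) (D.scenarioFeasible i)
      (s.x k i, s.y k i)
  penalty_subgradient : ∀ k, 1 ≤ k → k ≤ n → D.IsPenaltySubgradient (s.rho k) (s.pt k).m
  cuts_nonempty : ∀ k, 1 ≤ k → k ≤ n → (s.cuts k).Nonempty
  cuts_subset : ∀ k, 1 ≤ k → k ≤ n → s.cuts k ⊆ Finset.Icc 1 k
  cuts_add : ∀ k, 1 ≤ k → k ≤ n →
    k = 1 ∨ D.dualObjective v (s.pt k).m (s.pt k).lam < ((s.pt k).model v : EReal) →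
      k ∈ s.cuts k
  center_descent : ∀ k, 1 ≤ k → k ≤ n → D.IsDescent v κ s k →
    s.mbar k = (s.pt k).m ∧ s.lambar k = (s.pt k).lam
  center_null : ∀ k, 1 ≤ k → k ≤ n → ¬ D.IsDescent v κ s k →
    s.mbar k = s.mbar (k - 1) ∧ s.lambar k = s.lambar (k - 1)
  master : ∀ k, 1 ≤ k → k ≤ n → D.IsMasterOptimal v rg s k (s.pt (k + 1))

end TwoStageProblem

/-! For dual feasible (m, λ), weak duality gives F(m, λ) ≤ Λ_v(∑ mᵢ) ≤ P₂(v)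
(`dualObjective_le_lagrangeDual`, `lagrangeDual_le_refValue`). So it is enough that F is nearly
P₂(v) at the trial point n + 1.

Strong duality (`exists_hasDualValues_ge`) supplies a comparison point z, fixed before any run, with
F(z) near P₂(v). It comes from separating a point from a convex set of deviations and costs. That
set need not be closed, but compactness of the feasible set makes it closed near zero deviation,
which suffices.

For the method, let o be the center and w the next trial point. The cuts majorize F, so first-order
optimality of the master problem yields F(z) ≤ model(w) + 2ϱ⟨w - o, z - w⟩ (`le_model`). Taking z =
o and using the stopping condition, ‖w - o‖ is of order √ε. While F(o) < F(z), a descent step raises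
ϱ‖o - z‖² by at most the gain in F divided by κ. These gains telescope, so ‖o - z‖ is bounded
uniformly over all runs (`norm_center_sub_le`). Hence F(o) ≥ F(z) - ε - O(√ε)
(`center_near_optimal`). The center stays the same until iteration n + 1, where the descent test
keeps F at least F(o). -/

theorem EReal.coe_finsetSum {ι : Type*} (s : Finset ι) (f : ι → ℝ) :
    ((∑ i ∈ s, f i : ℝ) : EReal) = ∑ i ∈ s, (f i : EReal) := by
  classical
  induction s using Finset.induction_on with
  | empty => simp
  | insert a s ha ih => rw [Finset.sum_insert ha, Finset.sum_insert ha, EReal.coe_add, ih]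

/-! ### Acceptance sets of risk measures -/

namespace ConvexRiskMeasure

variable {I J : ℕ} (R : ConvexRiskMeasure I J)

theorem sub_mem_acceptance_iff (u : Fin I → Fin J → ℝ) (w : Fin J → ℝ) :
    (fun i => u i - w) ∈ R.acceptance ↔ w ∈ R.toFun u := by
  have h := R.translative u (-w)
  simp only [← sub_eq_add_neg] at h
  simp only [acceptance, Set.mem_ofPred_eq, h, Set.add_singleton, Set.mem_image]
  constructor
  · rintro ⟨x, hx, h0⟩
    rwa [← add_neg_eq_zero.mp h0]
  · exact fun hw => ⟨w, hw, add_neg_cancel w⟩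

theorem mem_toFun_of_le {u : Fin I → Fin J → ℝ} {w w' : Fin J → ℝ} (hw : w ∈ R.toFun u)
    (h : w ≤ w') : w' ∈ R.toFun u := by
  rw [← sub_mem_acceptance_iff] at hw ⊢
  exact R.monotone _ _ (fun i => sub_le_sub_left h _) hw

theorem mem_acceptance_of_le {u u' : Fin I → Fin J → ℝ} (hu : u ∈ R.acceptance) (h : u' ≤ u) :
    u' ∈ R.acceptance :=
  R.monotone _ _ h hu

theorem acceptance_nonempty : R.acceptance.Nonempty := by
  obtain ⟨w, hw⟩ := Set.nonempty_iff_ne_empty.mpr (R.nonempty 0)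
  exact ⟨_, (R.sub_mem_acceptance_iff 0 w).mpr hw⟩

theorem convex_acceptance : Convex ℝ R.acceptance := by
  rw [convex_iff_forall_pos]
  intro u hu u' hu' a b ha hb hab
  obtain rfl : b = 1 - a := by linarith
  refine R.convex u u' a ha (by linarith) ?_
  exact ⟨_, ⟨0, hu, rfl⟩, _, ⟨0, hu', rfl⟩, by simp⟩

end ConvexRiskMeasure

/-! ### Weak duality and finiteness of the scalarization -/

namespace TwoStageProblem

variable {I J K L M N : ℕ} (D : TwoStageProblem I J K L M N)

theorem scenarioFeasible_of_feasible {q : (Fin M → ℝ) × (Fin I → Fin N → ℝ)}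
    (hq : q ∈ D.feasible) (i : Fin I) : (q.1, q.2 i) ∈ D.scenarioFeasible i :=
  ⟨hq.1, hq.2.1 i, hq.2.2.1, hq.2.2.2 i⟩

theorem feasible_of_scenarioFeasible {q : (Fin M → ℝ) × (Fin I → Fin N → ℝ)}
    (hI : Nonempty (Fin I)) (h : ∀ i, (q.1, q.2 i) ∈ D.scenarioFeasible i) : q ∈ D.feasible :=
  ⟨(h hI.some).1, fun i => (h i).2.1, (h hI.some).2.2.1, fun i => (h i).2.2.2⟩

theorem nonempty_scenarios (D : TwoStageProblem I J K L M N) : Nonempty (Fin I) := by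
  by_contra h
  rw [not_nonempty_iff] at h
  simpa using D.p_sum

theorem sum_mul_dotProduct_eq_zero {lam : Fin I → Fin M → ℝ} (h : ∑ i, D.p i • lam i = 0)
    (x : Fin M → ℝ) : ∑ i, D.p i * (lam i ⬝ᵥ x) = 0 := by
  have := congrArg (· ⬝ᵥ x) h
  simpa [sum_dotProduct, smul_dotProduct] using this

theorem scenarioValue_le {i : Fin I} {q : (Fin M → ℝ) × (Fin N → ℝ)}
    (hq : q ∈ D.scenarioFeasible i) (mi : Fin J → ℝ) (lami : Fin M → ℝ) :
    D.scenarioValue i mi lami ≤ D.scenarioObjective i mi lami q :=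
  iInf₂_le q hq

theorem le_penalty {a : Fin I → Fin J → ℝ} (ha : a ∈ D.R.acceptance) (m : Fin I → Fin J → ℝ) :
    ((∑ i, m i ⬝ᵥ a i : ℝ) : EReal) ≤ D.penalty m :=
  le_iSup₂ (f := fun u (_ : u ∈ D.R.acceptance) => ((∑ i, m i ⬝ᵥ u i : ℝ) : EReal)) a ha

/-- A decision with a common first stage can be inserted in all scenario subproblems, where its
λ-terms cancel because λ has mean zero. The cost shifted by `w` is acceptable and serves as test
vector for the penalty. -/
theorem dualObjective_le_of_mem_feasible (v : Fin J → ℝ) {m : Fin I → Fin J → ℝ}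
    {lam : Fin I → Fin M → ℝ} (h : D.IsDualFeasible m lam)
    {q : (Fin M → ℝ) × (Fin I → Fin N → ℝ)} (hq : q ∈ D.feasible)
    {w : Fin J → ℝ} (hw : w ∈ D.R.toFun (D.cost q)) :
    D.dualObjective v m lam ≤ (((∑ i, m i) ⬝ᵥ (w - v) : ℝ) : EReal) := by
  have hf : ∑ i, D.scenarioValue i (m i) (lam i) ≤
      ((∑ i, D.scenarioObjective i (m i) (lam i) (q.1, q.2 i) : ℝ) : EReal) := by
    rw [EReal.coe_finsetSum]
    exact Finset.sum_le_sum fun i _ =>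
      D.scenarioValue_le (D.scenarioFeasible_of_feasible hq i) _ _
  have hp : ((∑ i, m i ⬝ᵥ (D.cost q i - w) : ℝ) : EReal) ≤ D.penalty m :=
    D.le_penalty ((D.R.sub_mem_acceptance_iff _ _).mpr hw) m
  refine (EReal.sub_le_sub (EReal.sub_le_sub hf hp) le_rfl).trans ?_
  rw [← EReal.coe_sub, ← EReal.coe_sub, EReal.coe_le_coe_iff]
  apply le_of_eq
  have h0 := D.sum_mul_dotProduct_eq_zero h.1 q.1
  simp only [scenarioObjective, Finset.sum_add_distrib, h0, dotProduct_sub, sum_dotProduct,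
    Finset.sum_sub_distrib, cost]
  ring

/-- The total mass of `m` is one, so the free variable α cancels in the Lagrangian. -/
theorem dualObjective_le_lagrangeDual (v : Fin J → ℝ) {m : Fin I → Fin J → ℝ}
    {lam : Fin I → Fin M → ℝ} (h : D.IsDualFeasible m lam) :
    D.dualObjective v m lam ≤ D.lagrangeDual v (∑ i, m i) := by
  refine le_iInf₂ fun q hq => le_iInf fun α => ?_
  rw [add_comm, ← EReal.sub_le_iff_le_add (by simp) (by simp)]
  refine le_iInf₂ fun z hz => ?_
  obtain ⟨w, hw, _, rfl, rfl⟩ := hz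
  rw [EReal.sub_le_iff_le_add (by simp) (by simp), ← EReal.coe_add]
  refine (D.dualObjective_le_of_mem_feasible v h hq hw).trans ?_
  rw [EReal.coe_le_coe_iff]
  apply le_of_eq
  have h1 : (∑ i, m i) ⬝ᵥ (fun _ => α) = α := by
    have := h.2.1
    rw [Finset.sum_comm] at this
    simp only [dotProduct, Finset.sum_apply, ← Finset.sum_mul, this, one_mul]
  simp only [dotProduct_sub, dotProduct_add, h1]
  ring

/-- Whenever α is admissible for the scalarization, the slack z = 0 is available in the inner
infimum. -/
theorem lagrangeDual_le_refValue (v γ : Fin J → ℝ) : D.lagrangeDual v γ ≤ D.refValue v := by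
  refine iInf₂_mono fun q hq => iInf_mono fun α => le_iInf fun h => ?_
  have h0 : (0 : Fin J → ℝ) ∈ D.R.toFun (D.cost q) - {v + fun _ => α} :=
    ⟨_, h, _, rfl, sub_self _⟩
  calc _ ≤ (α : EReal) + ((γ ⬝ᵥ (0 : Fin J → ℝ) : ℝ) : EReal) :=
        add_le_add le_rfl (iInf₂_le _ h0)
    _ = _ := by simp

theorem continuous_cost : Continuous D.cost := by
  unfold cost
  fun_prop

/-- Costs are bounded on the compact feasible set. If α were too small, the acceptable vector would
dominate `-z`, forcing into R(0) a point `z` chosen outside it. -/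
theorem exists_le_of_mem_toFun_cost (hX : IsCompact D.feasible) (v : Fin J → ℝ) :
    ∃ B : ℝ, ∀ q ∈ D.feasible, ∀ α : ℝ, (v + fun _ => α) ∈ D.R.toFun (D.cost q) → B ≤ α := by
  obtain ⟨B, hB⟩ := hX.exists_bound_of_continuousOn D.continuous_cost.continuousOn
  obtain ⟨z, hz⟩ := (Set.ne_univ_iff_exists_notMem _).mp (D.R.ne_univ 0)
  refine ⟨-(‖z‖ + ‖v‖ + B), fun q hq α hα => ?_⟩
  by_contra! hlt
  apply hz
  rw [← D.R.sub_mem_acceptance_iff] at hα ⊢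
  refine D.R.mem_acceptance_of_le hα fun i j => ?_
  have h1 := (norm_le_pi_norm (D.cost q i) j).trans ((norm_le_pi_norm (D.cost q) i).trans (hB q hq))
  have h2 := norm_le_pi_norm z j
  have h3 := norm_le_pi_norm v j
  rw [Real.norm_eq_abs, abs_le] at h1 h2 h3
  simp only [Pi.sub_apply, Pi.zero_apply, Pi.add_apply]
  linarith

theorem exists_mem_toFun_cost (v : Fin J → ℝ) (q : (Fin M → ℝ) × (Fin I → Fin N → ℝ)) :
    ∃ α : ℝ, (v + fun _ => α) ∈ D.R.toFun (D.cost q) := by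
  obtain ⟨w, hw⟩ := Set.nonempty_iff_ne_empty.mpr (D.R.nonempty (D.cost q))
  refine ⟨‖w‖ + ‖v‖, D.R.mem_toFun_of_le hw fun j => ?_⟩
  have h2 := norm_le_pi_norm w j
  have h3 := norm_le_pi_norm v j
  rw [Real.norm_eq_abs, abs_le] at h2 h3
  simp only [Pi.add_apply]
  linarith

theorem refValue_le {v : Fin J → ℝ} {q : (Fin M → ℝ) × (Fin I → Fin N → ℝ)}
    (hq : q ∈ D.feasible) {α : ℝ} (h : (v + fun _ => α) ∈ D.R.toFun (D.cost q)) :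
    D.refValue v ≤ α :=
  (iInf₂_le q hq).trans (iInf₂_le α h)

theorem exists_refValue_eq_coe (hX : IsCompact D.feasible) (hne : D.feasible.Nonempty)
    (v : Fin J → ℝ) : ∃ p : ℝ, D.refValue v = p := by
  obtain ⟨B, hB⟩ := D.exists_le_of_mem_toFun_cost hX v
  obtain ⟨q, hq⟩ := hne
  obtain ⟨α, hα⟩ := D.exists_mem_toFun_cost v q
  have htop : D.refValue v ≠ ⊤ := ne_top_of_le_ne_top (EReal.coe_ne_top α) (D.refValue_le hq hα)
  have hbot : D.refValue v ≠ ⊥ := by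
    refine ne_bot_of_le_ne_bot (EReal.coe_ne_bot B) ?_
    exact le_iInf₂ fun q hq => le_iInf₂ fun α h => EReal.coe_le_coe_iff.mpr (hB q hq α h)
  exact ⟨_, (EReal.coe_toReal htop hbot).symm⟩

end TwoStageProblem

/-! ### Strong duality by separation -/

theorem LinearMap.exists_eq_sum_dotProduct {I J : ℕ} (f : (Fin I → Fin J → ℝ) →ₗ[ℝ] ℝ) :
    ∃ m : Fin I → Fin J → ℝ, ∀ u, f u = ∑ i, m i ⬝ᵥ u i := by
  refine ⟨fun i j => f (Pi.single i (Pi.single j 1)), fun u => ?_⟩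
  have h : u = ∑ i, ∑ j, u i j • Pi.single i (Pi.single j (1 : ℝ)) := by
    ext i j
    simp [Finset.sum_apply, Pi.single_apply, apply_ite, ite_apply]
  conv_lhs => rw [h]
  simp only [map_sum, map_smul, dotProduct, smul_eq_mul, mul_comm]

namespace TwoStageProblem

variable {I J K L M N : ℕ} (D : TwoStageProblem I J K L M N)

/-- The product of the feasible sets of the scenarios, in which the first-stage decisions may
depend on the scenario. -/
def relaxedFeasible : Set (Fin I → (Fin M → ℝ) × (Fin N → ℝ)) :=
  {q | ∀ i, q i ∈ D.scenarioFeasible i}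

/-- The deviation of the first-stage decisions from their expectation. -/
def deviation : (Fin I → (Fin M → ℝ) × (Fin N → ℝ)) →ₗ[ℝ] (Fin I → Fin M → ℝ) where
  toFun q i := (q i).1 - ∑ j, D.p j • (q j).1
  map_add' q q' := by
    ext i
    simp [Finset.sum_add_distrib]
    ring
  map_smul' c q := by
    ext i
    simp [Finset.mul_sum, mul_sub, mul_left_comm]

/-- The cost vector of scenario-dependent decisions. -/
def relaxedCost : (Fin I → (Fin M → ℝ) × (Fin N → ℝ)) →ₗ[ℝ] (Fin I → Fin J → ℝ) where
  toFun q i := D.C *ᵥ (q i).1 + D.Q i *ᵥ (q i).2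
  map_add' q q' := by
    ext i
    simp [Matrix.mulVec_add]
    ring
  map_smul' c q := by
    ext i
    simp [Matrix.mulVec_smul]
    ring

theorem convex_scenarioFeasible (i : Fin I) : Convex ℝ (D.scenarioFeasible i) := by
  rintro q ⟨h1, h2, h3, h4⟩ q' ⟨h1', h2', h3', h4'⟩ a b ha hb hab
  refine ⟨?_, ?_, ?_, ?_⟩
  · exact add_nonneg (smul_nonneg ha h1) (smul_nonneg hb h1')
  · exact add_nonneg (smul_nonneg ha h2) (smul_nonneg hb h2')
  · simp only [Prod.fst_add, Prod.smul_fst, Matrix.mulVec_add, Matrix.mulVec_smul, h3, h3',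
      ← add_smul, hab, one_smul]
  · simp only [Prod.fst_add, Prod.smul_fst, Prod.snd_add, Prod.smul_snd, Matrix.mulVec_add,
      Matrix.mulVec_smul]
    rw [add_add_add_comm, ← smul_add, ← smul_add, h4, h4', ← add_smul, hab, one_smul]

theorem isClosed_scenarioFeasible (i : Fin I) : IsClosed (D.scenarioFeasible i) := by
  refine IsClosed.and (isClosed_le continuous_const continuous_fst) <|
    IsClosed.and (isClosed_le continuous_const continuous_snd) <|
    IsClosed.and (isClosed_eq ?_ continuous_const) (isClosed_eq ?_ continuous_const) <;> fun_prop

theorem convex_relaxedFeasible : Convex ℝ D.relaxedFeasible :=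
  fun _ hq _ hq' _ _ ha hb hab i => D.convex_scenarioFeasible i (hq i) (hq' i) ha hb hab

theorem isClosed_relaxedFeasible : IsClosed D.relaxedFeasible := by
  have : D.relaxedFeasible = ⋂ i, (fun q => q i) ⁻¹' D.scenarioFeasible i := by
    ext q
    simp [relaxedFeasible]
  rw [this]
  exact isClosed_iInter fun i => (D.isClosed_scenarioFeasible i).preimage (continuous_apply i)

theorem deviation_const (q : (Fin M → ℝ) × (Fin I → Fin N → ℝ)) :
    D.deviation (fun i => (q.1, q.2 i)) = 0 := by
  ext i
  simp [deviation, ← Finset.sum_mul, D.p_sum]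

theorem exists_mem_feasible_of_deviation_eq_zero {q : Fin I → (Fin M → ℝ) × (Fin N → ℝ)}
    (hq : q ∈ D.relaxedFeasible) (h : D.deviation q = 0) :
    ∃ q' ∈ D.feasible, q = fun i => (q'.1, q'.2 i) := by
  have h' : ∀ i, q i = (∑ j, D.p j • (q j).1, (q i).2) := fun i =>
    Prod.ext (sub_eq_zero.mp (congrFun h i)) rfl
  refine ⟨(∑ j, D.p j • (q j).1, fun i => (q i).2), ?_, funext h'⟩
  refine D.feasible_of_scenarioFeasible D.nonempty_scenarios fun i => ?_
  exact h' i ▸ hq i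

/-- The relaxed feasible set may be unbounded, but its points of zero deviation correspond to the
compact feasible set. On a large sphere the deviation is therefore bounded away from zero, and
convexity carries this bound to everything outside the ball. -/
theorem exists_compact_of_deviation_lt (hX : IsCompact D.feasible) (hne : D.feasible.Nonempty) :
    ∃ η : ℝ, 0 < η ∧ ∃ S ⊆ D.relaxedFeasible, IsCompact S ∧
      ∀ q ∈ D.relaxedFeasible, ‖D.deviation q‖ < η → q ∈ S := by
  obtain ⟨q₀, hq₀⟩ := hne
  set e : (Fin I → (Fin M → ℝ) × (Fin N → ℝ)) := fun i => (q₀.1, q₀.2 i) with he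
  have heP : e ∈ D.relaxedFeasible := D.scenarioFeasible_of_feasible hq₀
  have hdev : Continuous D.deviation := LinearMap.continuous_of_finiteDimensional _
  obtain ⟨B, hB⟩ := hX.exists_bound_of_continuousOn
    (f := fun q i => ((q.1, q.2 i) : (Fin M → ℝ) × (Fin N → ℝ)) - e i)
    (Continuous.continuousOn (by fun_prop))
  set r := |B| + 1 with hr
  have hr0 : 0 < r := by positivity
  have hpos : ∀ q ∈ D.relaxedFeasible ∩ Metric.sphere e r, 0 < ‖D.deviation q‖ := by
    rintro q ⟨hq, hqr⟩
    rw [norm_pos_iff]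
    intro h0
    obtain ⟨q', hq', rfl⟩ := D.exists_mem_feasible_of_deviation_eq_zero hq h0
    have h1 := hB q' hq'
    rw [mem_sphere_iff_norm] at hqr
    have h2 : ‖(fun i => ((q'.1, q'.2 i) : (Fin M → ℝ) × (Fin N → ℝ))) - e‖ ≤ B := h1
    linarith [le_abs_self B]
  obtain ⟨η, hη, hηS⟩ : ∃ η : ℝ, 0 < η ∧
      ∀ q ∈ D.relaxedFeasible ∩ Metric.sphere e r, η ≤ ‖D.deviation q‖ := by
    rcases (D.relaxedFeasible ∩ Metric.sphere e r).eq_empty_or_nonempty with h | h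
    · exact ⟨1, one_pos, by simp [h]⟩
    · obtain ⟨q, hq, hmin⟩ := ((isCompact_sphere e r).inter_left
        D.isClosed_relaxedFeasible).exists_isMinOn h hdev.norm.continuousOn
      exact ⟨_, hpos q hq, fun q' hq' => hmin hq'⟩
  refine ⟨η, hη, D.relaxedFeasible ∩ Metric.closedBall e r, Set.inter_subset_left,
    (isCompact_closedBall e r).inter_left D.isClosed_relaxedFeasible, fun q hq hlt => ⟨hq, ?_⟩⟩
  rw [mem_closedBall_iff_norm]
  by_contra! hgt
  have hn : 0 < ‖q - e‖ := hr0.trans hgt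
  set t := r / ‖q - e‖ with ht
  have ht0 : 0 < t := by positivity
  have ht1 : t ≤ 1 := (div_le_one hn).mpr hgt.le
  -- Since `e` has zero deviation, deviation scales linearly along the segment from `e` to `q`. The
  -- crossing point with the sphere then has deviation at most that of `q`, which is below `η`.
  have hmem : e + t • (q - e) ∈ D.relaxedFeasible ∩ Metric.sphere e r := by
    refine ⟨D.convex_relaxedFeasible.add_smul_sub_mem heP hq ⟨ht0.le, ht1⟩, ?_⟩
    rw [mem_sphere_iff_norm, add_sub_cancel_left, norm_smul, Real.norm_of_nonneg ht0.le, ht,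
      div_mul_cancel₀ _ hn.ne']
  have h1 := hηS _ hmem
  rw [map_add, map_smul, map_sub, he, D.deviation_const, zero_add, sub_zero, norm_smul,
    Real.norm_of_nonneg ht0.le] at h1
  have h2 := mul_le_mul_of_nonneg_right ht1 (norm_nonneg (D.deviation q))
  linarith

/-- Separation of the acceptance set from the costs of the relaxed problem. -/
theorem exists_separating_functional (hX : IsCompact D.feasible) (hne : D.feasible.Nonempty)
    (w : Fin J → ℝ) (hw : ∀ q ∈ D.feasible, w ∉ D.R.toFun (D.cost q)) :
    ∃ (μ : Fin I → Fin M → ℝ) (m : Fin I → Fin J → ℝ),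
      ∀ q ∈ D.relaxedFeasible, ∀ a ∈ D.R.acceptance,
        ∑ i, m i ⬝ᵥ w < ∑ i, μ i ⬝ᵥ D.deviation q i + ∑ i, m i ⬝ᵥ (D.relaxedCost q i - a i) := by
  obtain ⟨η, hη, S, hSP, hS, hSη⟩ := D.exists_compact_of_deviation_lt hX hne
  set Φ := D.deviation.prod D.relaxedCost with hΦ
  have hΦc : Continuous Φ := LinearMap.continuous_of_finiteDimensional _
  set A' : Set ((Fin I → Fin M → ℝ) × (Fin I → Fin J → ℝ)) := {0} ×ˢ D.R.acceptance with hA'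
  have hA'c : IsClosed A' := isClosed_singleton.prod D.R.closed
  have hconv : Convex ℝ (closure (Φ '' D.relaxedFeasible - A')) :=
    ((D.convex_relaxedFeasible.linear_image Φ).sub
      ((convex_singleton _).prod D.R.convex_acceptance)).closure
  -- A compact set plus a closed set is closed; this is where closedness of the acceptance set
  -- enters.
  have hSc : IsClosed (Φ '' S - A') := by
    rw [sub_eq_add_neg]
    exact hA'c.neg.add_left_of_isCompact (hS.image hΦc)
  have hnot : ((0, fun _ => w) : (Fin I → Fin M → ℝ) × (Fin I → Fin J → ℝ)) ∉
      closure (Φ '' D.relaxedFeasible - A') := by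
    intro hmem
    -- Only the closure near zero deviation matters: inside this open strip the difference set is
    -- contained in the closed set built from `S`.
    have hU : IsOpen {z : (Fin I → Fin M → ℝ) × (Fin I → Fin J → ℝ) | ‖z.1‖ < η} :=
      isOpen_lt continuous_fst.norm continuous_const
    have h0 : ((0, fun _ => w) : (Fin I → Fin M → ℝ) × (Fin I → Fin J → ℝ)) ∈
        {z : (Fin I → Fin M → ℝ) × (Fin I → Fin J → ℝ) | ‖z.1‖ < η} := by
      rw [Set.mem_ofPred_eq, norm_zero]
      exact hη
    have h1 := hU.inter_closure ⟨h0, hmem⟩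
    have h2 : {z : (Fin I → Fin M → ℝ) × (Fin I → Fin J → ℝ) | ‖z.1‖ < η} ∩
        (Φ '' D.relaxedFeasible - A') ⊆ Φ '' S - A' := by
      rintro _ ⟨hz, _, ⟨q, hq, rfl⟩, ⟨a₁, a₂⟩, ha, rfl⟩
      obtain ⟨rfl, ha2⟩ := ha
      refine ⟨_, ⟨q, hSη q hq ?_, rfl⟩, _, ⟨Set.mem_singleton _, ha2⟩, rfl⟩
      simpa [hΦ] using hz
    obtain ⟨_, ⟨q, hq, rfl⟩, ⟨a₁, a₂⟩, ha, heq⟩ := closure_minimal h2 hSc h1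
    obtain ⟨rfl, ha2⟩ := ha
    have hd : D.deviation q = 0 := by simpa [hΦ] using congrArg Prod.fst heq
    have hc : D.relaxedCost q - a₂ = fun _ => w := congrArg Prod.snd heq
    obtain ⟨q', hq', rfl⟩ := D.exists_mem_feasible_of_deviation_eq_zero (hSP hq) hd
    apply hw q' hq'
    rw [← D.R.sub_mem_acceptance_iff]
    convert ha2 using 1
    ext1 i
    have := congrFun hc i
    simp only [Pi.sub_apply] at this
    rw [← this]
    simp [cost, relaxedCost]
  obtain ⟨f, u, hfu, hf⟩ := geometric_hahn_banach_point_closed hconv isClosed_closure hnot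
  obtain ⟨μ, hμ⟩ := LinearMap.exists_eq_sum_dotProduct
    (f.toLinearMap ∘ₗ LinearMap.inl ℝ (Fin I → Fin M → ℝ) (Fin I → Fin J → ℝ))
  obtain ⟨m, hm⟩ := LinearMap.exists_eq_sum_dotProduct
    (f.toLinearMap ∘ₗ LinearMap.inr ℝ (Fin I → Fin M → ℝ) (Fin I → Fin J → ℝ))
  have hfz : ∀ d e, f (d, e) = ∑ i, μ i ⬝ᵥ d i + ∑ i, m i ⬝ᵥ e i := by
    intro d e
    rw [← hμ, ← hm]
    simp [← map_add]
  refine ⟨μ, m, fun q hq a ha => ?_⟩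
  have h1 := hf (Φ q - (0, a)) 
      (subset_closure ⟨_, ⟨q, hq, rfl⟩, _, ⟨Set.mem_singleton _, ha⟩, rfl⟩)
  have h2 : Φ q - (0, a) = (D.deviation q, D.relaxedCost q - a) := by simp [hΦ]
  rw [h2, hfz] at h1
  rw [hfz] at hfu
  simp only [Pi.zero_apply, dotProduct_zero, Finset.sum_const_zero, zero_add] at hfu
  exact hfu.trans h1

/-- A multiplier pair whose dual objective is at least `r`, in terms of the Lagrangian. -/
theorem exists_isDualFeasible_lagrangian (hX : IsCompact D.feasible) (hne : D.feasible.Nonempty)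
    (v : Fin J → ℝ) (r : ℝ) (hr : (r : EReal) < D.refValue v) :
    ∃ m lam, D.IsDualFeasible m lam ∧ ∀ q ∈ D.relaxedFeasible, ∀ a ∈ D.R.acceptance,
      r + ∑ i, m i ⬝ᵥ v ≤
        ∑ i, D.scenarioObjective i (m i) (lam i) (q i) - ∑ i, m i ⬝ᵥ a i := by
  have hw : ∀ q ∈ D.feasible, (v + fun _ => r) ∉ D.R.toFun (D.cost q) := fun q hq h =>
    absurd (D.refValue_le hq h) (not_le.mpr hr)
  obtain ⟨μ, m, h⟩ := D.exists_separating_functional hX hne _ hw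
  obtain ⟨q₀, hq₀⟩ := hne
  obtain ⟨a₀, ha₀⟩ := D.R.acceptance_nonempty
  have he := D.scenarioFeasible_of_feasible hq₀
  have hm0 : 0 ≤ m := by
    intro i j
    by_contra! hneg
    simp only [Pi.zero_apply] at hneg
    set c₁ := ∑ i, m i ⬝ᵥ (v + fun _ => r) with hc1
    set c₂ := ∑ i, μ i ⬝ᵥ D.deviation (fun i => (q₀.1, q₀.2 i)) i +
      ∑ i, m i ⬝ᵥ (D.relaxedCost (fun i => (q₀.1, q₀.2 i)) i - a₀ i) with hc2
    -- The acceptance set is a lower set, so a negative weight would let the right-hand side tend to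
    -- -∞.
    have key : ∀ t : ℝ, 0 ≤ t → c₁ < c₂ + t * m i j := by
      intro t ht
      have h1 := h _ he (a₀ - Pi.single i (Pi.single j t)) (D.R.mem_acceptance_of_le ha₀ ?_)
      · refine h1.trans_eq ?_
        have h2 : ∑ i', m i' ⬝ᵥ (Pi.single i (Pi.single j t) : Fin I → Fin J → ℝ) i' =
            t * m i j := by
          rw [Finset.sum_eq_single i]
          · simp [mul_comm]
          · intro b _ hb
            simp [Pi.single_eq_of_ne hb]
          · simp
        rw [hc2, ← h2]
        simp only [Pi.sub_apply, dotProduct_sub, Finset.sum_sub_distrib]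
        ring
      · refine sub_le_self _ ?_
        simpa using ht
    have h0 := key 0 le_rfl
    -- This `t` makes the right-hand side exactly `c₁`.
    have h1 := key ((c₂ - c₁) / (-m i j)) (div_nonneg (by linarith) (by linarith))
    have h2 : (c₂ - c₁) / (-m i j) * m i j = c₁ - c₂ := by
      rw [div_neg, neg_mul, div_mul_cancel₀ _ hneg.ne]
      ring
    linarith
  set σ := ∑ i, ∑ j, m i j with hσ
  have hσ0 : 0 ≤ σ := Finset.sum_nonneg fun i _ => Finset.sum_nonneg fun j _ => hm0 i j
  -- If `m` vanished, the strict separation at a point of zero deviation would read 0 < 0.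
  have hσpos : 0 < σ := by
    refine lt_of_le_of_ne hσ0 fun h0 => ?_
    have hz : m = 0 := by
      ext i j
      have h1 := (Finset.sum_eq_zero_iff_of_nonneg
        (fun i _ => Finset.sum_nonneg fun j _ => hm0 i j)).mp h0.symm i (Finset.mem_univ i)
      exact (Finset.sum_eq_zero_iff_of_nonneg (fun j _ => hm0 i j)).mp h1 j (Finset.mem_univ j)
    have h1 := h _ he a₀ ha₀
    rw [hz, D.deviation_const] at h1
    simp at h1
  -- Subtracting ∑ μⱼ gives λ mean zero, and moves the expectation inside the deviation onto the
  -- multiplier: ∑ pᵢ λᵢ·xᵢ equals σ⁻¹ times the pairing of μ with the deviation.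
  refine ⟨σ⁻¹ • m, fun i => σ⁻¹ • ((D.p i)⁻¹ • μ i - ∑ j, μ j), ⟨?_, ?_, ?_⟩, ?_⟩
  · have : ∀ i, D.p i • σ⁻¹ • ((D.p i)⁻¹ • μ i - ∑ j, μ j) =
        σ⁻¹ • (μ i - D.p i • ∑ j, μ j) := by
      intro i
      rw [smul_comm, smul_sub, smul_smul (D.p i), mul_inv_cancel₀ (D.p_pos i).ne', one_smul]
    simp only [this, ← Finset.smul_sum, Finset.sum_sub_distrib, ← Finset.sum_smul, D.p_sum,
      one_smul, sub_self, smul_zero]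
  · simp only [Pi.smul_apply, smul_eq_mul, ← Finset.mul_sum]
    exact inv_mul_cancel₀ hσpos.ne'
  · exact smul_nonneg (inv_nonneg.mpr hσ0) hm0
  · intro q hq a ha
    have h1 := mul_le_mul_of_nonneg_left (h q hq a ha).le (inv_nonneg.mpr hσ0)
    have hr1 : ∑ i, m i ⬝ᵥ (v + fun _ => r) = ∑ i, m i ⬝ᵥ v + σ * r := by
      simp only [dotProduct_add, Finset.sum_add_distrib, hσ, Finset.sum_mul]
      simp [dotProduct]
    have hlam : ∀ i, D.p i * ((σ⁻¹ • ((D.p i)⁻¹ • μ i - ∑ j, μ j)) ⬝ᵥ (q i).1) =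
        σ⁻¹ * (μ i ⬝ᵥ (q i).1 - D.p i * ((∑ j, μ j) ⬝ᵥ (q i).1)) := by
      intro i
      have := (D.p_pos i).ne'
      simp only [smul_dotProduct, sub_dotProduct, smul_eq_mul]
      field_simp
    have hdev : ∑ i, μ i ⬝ᵥ D.deviation q i =
        ∑ i, (μ i ⬝ᵥ (q i).1 - D.p i * ((∑ j, μ j) ⬝ᵥ (q i).1)) := by
      have h3 : ∀ i, D.deviation q i = (q i).1 - ∑ j, D.p j • (q j).1 := fun i => rfl
      simp only [h3, dotProduct_sub, Finset.sum_sub_distrib, ← sum_dotProduct]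
      rw [dotProduct_sum]
      simp only [dotProduct_smul, smul_eq_mul]
    rw [hr1, hdev] at h1
    have h4 : ∑ i, D.scenarioObjective i ((σ⁻¹ • m) i)
          (σ⁻¹ • ((D.p i)⁻¹ • μ i - ∑ j, μ j)) (q i) =
        σ⁻¹ * (∑ i, (μ i ⬝ᵥ (q i).1 - D.p i * ((∑ j, μ j) ⬝ᵥ (q i).1)) +
          ∑ i, m i ⬝ᵥ D.relaxedCost q i) := by
      simp only [scenarioObjective, hlam]
      simp only [Finset.sum_add_distrib, ← Finset.mul_sum, Pi.smul_apply, smul_dotProduct,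
        smul_eq_mul, relaxedCost, LinearMap.coe_mk, AddHom.coe_mk]
      ring
    rw [h4]
    simp only [Pi.smul_apply, smul_dotProduct, smul_eq_mul, ← Finset.mul_sum]
    simp only [dotProduct_sub, Finset.sum_sub_distrib] at h1 ⊢
    have h5 : σ⁻¹ * (σ * r) = r := by field_simp
    linarith

/-- The scenario subproblems and the penalty function have the finite values `th` and `pe`. -/
def HasDualValues (m : Fin I → Fin J → ℝ) (lam : Fin I → Fin M → ℝ) (th : Fin I → ℝ) (pe : ℝ) :
    Prop :=
  (∀ i, D.scenarioValue i (m i) (lam i) = th i) ∧ D.penalty m = pe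

theorem HasDualValues.dualObjective_eq {D : TwoStageProblem I J K L M N} {m : Fin I → Fin J → ℝ}
    {lam : Fin I → Fin M → ℝ} {th : Fin I → ℝ} {pe : ℝ} (h : D.HasDualValues m lam th pe)
    (v : Fin J → ℝ) :
    D.dualObjective v m lam = ((∑ i, th i - pe - ∑ i, m i ⬝ᵥ v : ℝ) : EReal) := by
  simp only [dualObjective, h.1, h.2, EReal.coe_sub, EReal.coe_finsetSum]

theorem penalty_ne_bot (m : Fin I → Fin J → ℝ) : D.penalty m ≠ ⊥ := by
  obtain ⟨a, ha⟩ := D.R.acceptance_nonempty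
  exact ne_bot_of_le_ne_bot (EReal.coe_ne_bot _) (D.le_penalty ha m)

/-- Strong duality, up to an arbitrarily small error. -/
theorem exists_hasDualValues_ge (hX : IsCompact D.feasible) (hne : D.feasible.Nonempty)
    (v : Fin J → ℝ) (r : ℝ) (hr : (r : EReal) < D.refValue v) :
    ∃ m lam th pe, D.IsDualFeasible m lam ∧ D.HasDualValues m lam th pe ∧
      r ≤ ∑ i, th i - pe - ∑ i, m i ⬝ᵥ v := by
  obtain ⟨m, lam, hfeas, h⟩ := D.exists_isDualFeasible_lagrangian hX hne v r hr
  obtain ⟨q₀, hq₀⟩ := hne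
  obtain ⟨a₀, ha₀⟩ := D.R.acceptance_nonempty
  have he := D.scenarioFeasible_of_feasible hq₀
  have hpen : D.penalty m ≠ ⊤ := by
    refine ne_top_of_le_ne_top (EReal.coe_ne_top
      (∑ i, D.scenarioObjective i (m i) (lam i) (q₀.1, q₀.2 i) - (r + ∑ i, m i ⬝ᵥ v))) ?_
    refine iSup₂_le fun a ha => EReal.coe_le_coe_iff.mpr ?_
    have := h _ he a ha
    linarith
  have hval : ∀ i, D.scenarioValue i (m i) (lam i) ≠ ⊥ := by
    intro i
    refine ne_bot_of_le_ne_bot (EReal.coe_ne_bot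
      (r + ∑ i, m i ⬝ᵥ v + ∑ i, m i ⬝ᵥ a₀ i -
        ∑ j ∈ Finset.univ.erase i, D.scenarioObjective j (m j) (lam j) (q₀.1, q₀.2 j))) ?_
    refine le_iInf₂ fun q hq => EReal.coe_le_coe_iff.mpr ?_
    -- Only the decision of scenario `i` varies, so the joint bound becomes a bound for one
    -- subproblem.
    have h1 := h (Function.update (fun j => (q₀.1, q₀.2 j)) i q) ?_ a₀ ha₀
    · rw [← Finset.add_sum_erase _ (fun j => D.scenarioObjective j (m j) (lam j) _)
          (Finset.mem_univ i), Function.update_self,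
        Finset.sum_congr (s₁ := Finset.univ.erase i) rfl
          (g := fun j => D.scenarioObjective j (m j) (lam j) (q₀.1, q₀.2 j))
          (fun j hj => by rw [Function.update_of_ne (Finset.ne_of_mem_erase hj)])] at h1
      linarith
    · intro j
      rcases eq_or_ne j i with rfl | hj
      · simpa using hq
      · simpa [Function.update_of_ne hj] using he j
  have hth : ∀ i, ∃ t : ℝ, D.scenarioValue i (m i) (lam i) = t := fun i =>
    ⟨_, (EReal.coe_toReal (ne_top_of_le_ne_top (EReal.coe_ne_top _)
      (D.scenarioValue_le (he i) _ _)) (hval i)).symm⟩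
  choose th hth using hth
  obtain ⟨pe, hpe⟩ : ∃ t : ℝ, D.penalty m = t :=
    ⟨_, (EReal.coe_toReal hpen (D.penalty_ne_bot m)).symm⟩
  refine ⟨m, lam, th, pe, hfeas, ⟨hth, hpe⟩, le_of_forall_pos_le_add fun ε hε => ?_⟩
  -- There are `I` near-minimizers and one near-maximizer of the penalty, each losing at most `η`.
  set η := ε / (I + 1) with hη
  have hη0 : 0 < η := by positivity
  have hq : ∀ i, ∃ q ∈ D.scenarioFeasible i, D.scenarioObjective i (m i) (lam i) q < th i + η := by
    intro i
    have h1 : D.scenarioValue i (m i) (lam i) < ((th i + η : ℝ) : EReal) := by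
      rw [hth, EReal.coe_lt_coe_iff]
      linarith
    obtain ⟨q, hq, hlt⟩ := by simpa only [scenarioValue, iInf_lt_iff] using h1
    exact ⟨q, hq, EReal.coe_lt_coe_iff.mp hlt⟩
  choose q hq hqlt using hq
  obtain ⟨a, ha, halt⟩ : ∃ a ∈ D.R.acceptance, pe - η < ∑ i, m i ⬝ᵥ a i := by
    have h1 : ((pe - η : ℝ) : EReal) < D.penalty m := by
      rw [hpe, EReal.coe_lt_coe_iff]
      linarith
    obtain ⟨a, ha, hlt⟩ := by simpa only [penalty, lt_iSup_iff] using h1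
    exact ⟨a, ha, EReal.coe_lt_coe_iff.mp hlt⟩
  have h1 := h q hq a ha
  have h2 : ∑ i, D.scenarioObjective i (m i) (lam i) (q i) ≤ ∑ i, th i + I * η := by
    calc _ ≤ ∑ i, (th i + η) := Finset.sum_le_sum fun i _ => (hqlt i).le
      _ = _ := by simp [Finset.sum_add_distrib]
  have h3 : (I : ℝ) * η + η = ε := by
    rw [hη]
    field_simp
  linarith

end TwoStageProblem

/-! ### Convexity and optimality in the master problem -/

theorem EReal.coe_convexComb_le {S : EReal} {x x' a a' t : ℝ} (ht0 : 0 ≤ t) (ht1 : t ≤ 1)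
    (h : (x : EReal) ≤ S + (a : EReal)) (h' : (x' : EReal) ≤ S + (a' : EReal)) :
    (((1 - t) * x + t * x' : ℝ) : EReal) ≤ S + (((1 - t) * a + t * a' : ℝ) : EReal) := by
  induction S with
  | bot => simp at h
  | top => exact le_top.trans_eq (EReal.top_add_coe _).symm
  | coe S =>
    rw [← EReal.coe_add, EReal.coe_le_coe_iff] at h h' ⊢
    have h1 := mul_le_mul_of_nonneg_left h (_root_.sub_nonneg.mpr ht1)
    have h2 := mul_le_mul_of_nonneg_left h' ht0
    linarith

/-- Divide by t and let t tend to 0; the proof uses one explicit small t instead. -/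
theorem le_of_forall_mul_le_add_sq {a b d : ℝ} (hb : 0 ≤ b)
    (h : ∀ t : ℝ, 0 < t → t ≤ 1 → t * d ≤ t * a + t ^ 2 * b) : d ≤ a := by
  by_contra! hlt
  have hg : 0 < d - a := sub_pos.mpr hlt
  have hgb : 0 < d - a + b := by linarith
  set t := (d - a) / (d - a + b) with ht
  have ht0 : 0 < t := div_pos hg hgb
  have h1 := h t ht0 ((div_le_one hgb).mpr (by linarith))
  have h2 : t * (d - a + b) = d - a := div_mul_cancel₀ _ hgb.ne'
  have h3 : t * (d - a) ≤ t * (t * b) := by nlinarith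
  have h4 := le_of_mul_le_mul_left h3 ht0
  nlinarith [mul_pos ht0 hg]

/-- A pair of dual variables as a point of a Euclidean space. -/
def dualVec {I J M : ℕ} (m : Fin I → Fin J → ℝ) (lam : Fin I → Fin M → ℝ) :
    EuclideanSpace ℝ ((Fin I × Fin J) ⊕ (Fin I × Fin M)) :=
  WithLp.toLp 2 (Sum.elim (fun a => m a.1 a.2) fun a => lam a.1 a.2)

theorem norm_dualVec_sub_sq {I J M : ℕ} (m m' : Fin I → Fin J → ℝ) (lam lam' : Fin I → Fin M → ℝ) :
    ‖dualVec m lam - dualVec m' lam'‖ ^ 2 =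
      ∑ i, (m i - m' i) ⬝ᵥ (m i - m' i) + ∑ i, (lam i - lam' i) ⬝ᵥ (lam i - lam' i) := by
  rw [EuclideanSpace.real_norm_sq_eq, Fintype.sum_sum_type, Fintype.sum_prod_type,
    Fintype.sum_prod_type]
  simp [dualVec, dotProduct, sq]

theorem BundleIterates.masterObjective_eq {I J M N : ℕ} (s : BundleIterates I J M N)
    (v : Fin J → ℝ) (rg : ℝ) (k : ℕ) (P : MasterPoint I J M) :
    s.masterObjective v rg k P =
      P.model v - rg * ‖dualVec P.m P.lam - dualVec (s.mbar k) (s.lambar k)‖ ^ 2 := by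
  rw [norm_dualVec_sub_sq, masterObjective, ← Finset.mul_sum, ← Finset.mul_sum]
  ring

/-- The point `(1 - t) P + t P'`. -/
def MasterPoint.convexComb {I J M : ℕ} (P P' : MasterPoint I J M) (t : ℝ) : MasterPoint I J M where
  m := (1 - t) • P.m + t • P'.m
  lam := (1 - t) • P.lam + t • P'.lam
  theta := (1 - t) • P.theta + t • P'.theta
  eta := (1 - t) * P.eta + t * P'.eta

namespace MasterPoint

variable {I J M : ℕ} (P P' : MasterPoint I J M) (t : ℝ)

theorem model_convexComb (v : Fin J → ℝ) :
    (P.convexComb P' t).model v = (1 - t) * P.model v + t * P'.model v := by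
  simp only [model, convexComb, Pi.add_apply, Pi.smul_apply, smul_eq_mul, Finset.sum_add_distrib,
    ← Finset.mul_sum, add_dotProduct, smul_dotProduct]
  ring

theorem dualVec_convexComb :
    dualVec (P.convexComb P' t).m (P.convexComb P' t).lam =
      dualVec P.m P.lam + t • (dualVec P'.m P'.lam - dualVec P.m P.lam) := by
  ext a
  rcases a with a | a <;> simp [dualVec, convexComb] <;> ring

end MasterPoint

namespace TwoStageProblem

variable {I J K L M N : ℕ} (D : TwoStageProblem I J K L M N)

theorem IsDualFeasible.convexComb {D : TwoStageProblem I J K L M N} {m m' : Fin I → Fin J → ℝ}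
    {lam lam' : Fin I → Fin M → ℝ} (h : D.IsDualFeasible m lam) (h' : D.IsDualFeasible m' lam')
    {t : ℝ} (ht0 : 0 ≤ t) (ht1 : t ≤ 1) :
    D.IsDualFeasible ((1 - t) • m + t • m') ((1 - t) • lam + t • lam') := by
  refine ⟨?_, ?_, ?_⟩
  · simp only [Pi.add_apply, Pi.smul_apply, smul_add, Finset.sum_add_distrib, smul_comm (D.p _),
      ← Finset.smul_sum, h.1, h'.1, smul_zero, add_zero]
  · simp only [Pi.add_apply, Pi.smul_apply, smul_eq_mul, Finset.sum_add_distrib, ← Finset.mul_sum,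
      h.2.1, h'.2.1]
    ring
  · exact add_nonneg (smul_nonneg (sub_nonneg.mpr ht1) h.2.2) (smul_nonneg ht0 h'.2.2)

theorem IsMasterFeasible.convexComb {D : TwoStageProblem I J K L M N}
    {s : BundleIterates I J M N} {k : ℕ} {P P' : MasterPoint I J M}
    (h : D.IsMasterFeasible s k P) (h' : D.IsMasterFeasible s k P') {t : ℝ} (ht0 : 0 ≤ t)
    (ht1 : t ≤ 1) : D.IsMasterFeasible s k (P.convexComb P' t) := by
  refine ⟨fun i l hl => ?_, fun l hl => ?_, h.2.2.convexComb h'.2.2 ht0 ht1⟩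
  · refine (EReal.coe_convexComb_le ht0 ht1 (h.1 i l hl) (h'.1 i l hl)).trans_eq ?_
    congr 2
    simp only [MasterPoint.convexComb, Pi.add_apply, Pi.smul_apply, dotProduct_sub, dotProduct_add,
      dotProduct_smul, smul_eq_mul]
    ring
  · refine (EReal.coe_convexComb_le ht0 ht1 (h.2.1 l hl) (h'.2.1 l hl)).trans_eq ?_
    congr 2
    simp only [MasterPoint.convexComb, Pi.add_apply, Pi.smul_apply, dotProduct_sub, dotProduct_add,
      dotProduct_smul, smul_eq_mul, Finset.sum_sub_distrib, Finset.sum_add_distrib,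
      ← Finset.mul_sum]
    ring

/-- The first-order optimality condition of the master problem. -/
theorem IsMasterOptimal.model_le {D : TwoStageProblem I J K L M N} {v : Fin J → ℝ} {rg : ℝ}
    (hrg : 0 < rg) {s : BundleIterates I J M N} {k : ℕ} {P P' : MasterPoint I J M}
    (h : D.IsMasterOptimal v rg s k P) (h' : D.IsMasterFeasible s k P') :
    P'.model v ≤ P.model v + 2 * rg * inner ℝ
      (dualVec P.m P.lam - dualVec (s.mbar k) (s.lambar k))
      (dualVec P'.m P'.lam - dualVec P.m P.lam) := by
  set a := dualVec P.m P.lam - dualVec (s.mbar k) (s.lambar k) with ha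
  set d := dualVec P'.m P'.lam - dualVec P.m P.lam with hd
  rw [← sub_le_iff_le_add']
  -- Optimality is tested along the segment towards `P'`: the model is affine there, and the
  -- quadratic term contributes its derivative plus a term of order t².
  refine le_of_forall_mul_le_add_sq (b := rg * ‖d‖ ^ 2) (by positivity) fun t ht0 ht1 => ?_
  have h1 := h.2 _ (h.1.convexComb h' ht0.le ht1)
  rw [s.masterObjective_eq, s.masterObjective_eq, MasterPoint.model_convexComb,
    MasterPoint.dualVec_convexComb, ← hd,
    add_sub_right_comm (dualVec P.m P.lam), ← ha, norm_add_sq_real,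
    inner_smul_right, norm_smul, mul_pow, Real.norm_eq_abs, sq_abs] at h1
  linarith

/-- `f` is the finite dual objective value of the dual feasible pair `(m, lam)`. -/
def IsDualValue (v : Fin J → ℝ) (m : Fin I → Fin J → ℝ) (lam : Fin I → Fin M → ℝ) (f : ℝ) :
    Prop :=
  D.IsDualFeasible m lam ∧ ∃ th pe, D.HasDualValues m lam th pe ∧
    f = ∑ i, th i - pe - ∑ i, m i ⬝ᵥ v

variable {D} {v : Fin J → ℝ} {rg κ : ℝ} {s : BundleIterates I J M N} {n : ℕ}

theorem IsDualValue.dualObjective_eq {m : Fin I → Fin J → ℝ} {lam : Fin I → Fin M → ℝ} {f : ℝ}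
    (h : D.IsDualValue v m lam f) : D.dualObjective v m lam = f := by
  obtain ⟨-, th, pe, hv, rfl⟩ := h
  exact hv.dualObjective_eq v

/-! ### Estimates along a run -/

namespace IsRun

theorem scenarioValue_eq (hs : D.IsRun v rg κ s n) {l : ℕ} (hl1 : 1 ≤ l) (hln : l ≤ n)
    (i : Fin I) : D.scenarioValue i ((s.pt l).m i) ((s.pt l).lam i) =
      D.scenarioObjective i ((s.pt l).m i) ((s.pt l).lam i) (s.x l i, s.y l i) :=
  le_antisymm (D.scenarioValue_le (hs.subproblem_mem l hl1 hln i) _ _)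
    (le_iInf₂ fun _ hq => EReal.coe_le_coe_iff.mpr (hs.subproblem_min l hl1 hln i hq))

theorem isDualFeasible_pt (hs : D.IsRun v rg κ s n) {l : ℕ} (hl1 : 1 ≤ l) (hln : l ≤ n + 1) :
    D.IsDualFeasible (s.pt l).m (s.pt l).lam := by
  rcases hl1.eq_or_lt with rfl | h
  · exact hs.init
  · obtain ⟨k, rfl⟩ := Nat.exists_eq_add_of_le' hl1
    exact (hs.master k (by omega) (by omega)).1.2.2

theorem exists_isDualValue_pt (hs : D.IsRun v rg κ s n) {l : ℕ} (hl1 : 1 ≤ l) (hln : l ≤ n) :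
    ∃ f, D.IsDualValue v (s.pt l).m (s.pt l).lam f :=
  ⟨_, hs.isDualFeasible_pt hl1 (by omega), _, _, ⟨hs.scenarioValue_eq hl1 hln,
    (EReal.coe_toReal (hs.penalty_subgradient l hl1 hln).1 (D.penalty_ne_bot _)).symm⟩, rfl⟩

/-- Every center is a trial point whose subproblems were solved, so it inherits a finite dual value.
-/
theorem exists_center_eq_pt (hs : D.IsRun v rg κ s n) {k : ℕ} (hk1 : 1 ≤ k) (hkn : k ≤ n) :
    ∃ l, 1 ≤ l ∧ l ≤ n ∧ s.mbar k = (s.pt l).m ∧ s.lambar k = (s.pt l).lam := by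
  induction k, hk1 using Nat.le_induction with
  | base => exact ⟨1, le_rfl, hkn, hs.center_descent 1 le_rfl hkn (Or.inl rfl)⟩
  | succ k hk ih =>
    by_cases hd : D.IsDescent v κ s (k + 1)
    · exact ⟨k + 1, by omega, hkn, hs.center_descent _ (by omega) hkn hd⟩
    · have h := hs.center_null _ (by omega) hkn hd
      rw [Nat.add_sub_cancel] at h
      rw [h.1, h.2]
      exact ih (by omega)

theorem exists_isDualValue_center (hs : D.IsRun v rg κ s n) {k : ℕ} (hk1 : 1 ≤ k) (hkn : k ≤ n) :
    ∃ f, D.IsDualValue v (s.mbar k) (s.lambar k) f := by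
  obtain ⟨l, hl1, hln, h1, h2⟩ := hs.exists_center_eq_pt hk1 hkn
  rw [h1, h2]
  exact hs.exists_isDualValue_pt hl1 hln

/-- The cuts overestimate the dual objective. -/
theorem isMasterFeasible_of_hasDualValues (hs : D.IsRun v rg κ s n) {k : ℕ} (hk1 : 1 ≤ k)
    (hkn : k ≤ n) {m : Fin I → Fin J → ℝ} {lam : Fin I → Fin M → ℝ} {th : Fin I → ℝ} {pe : ℝ}
    (hf : D.IsDualFeasible m lam) (h : D.HasDualValues m lam th pe) :
    D.IsMasterFeasible s k ⟨m, lam, th, -pe⟩ := by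
  refine ⟨fun i l hl => ?_, fun l hl => ?_, hf⟩
  · obtain ⟨hl1, hlk⟩ := Finset.mem_Icc.mp (hs.cuts_subset k hk1 hkn hl)
    rw [hs.scenarioValue_eq hl1 (hlk.trans hkn), ← h.1 i, ← EReal.coe_add]
    refine (D.scenarioValue_le (hs.subproblem_mem l hl1 (hlk.trans hkn) i) _ _).trans_eq ?_
    congr 1
    simp only [scenarioObjective, dotProduct_sub, smul_dotProduct, smul_eq_mul]
    rw [dotProduct_comm _ (m i), dotProduct_comm _ ((s.pt l).m i), dotProduct_comm _ (lam i),
      dotProduct_comm _ ((s.pt l).lam i)]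
    ring
  · obtain ⟨hl1, hlk⟩ := Finset.mem_Icc.mp (hs.cuts_subset k hk1 hkn hl)
    have h1 := (hs.penalty_subgradient l hl1 (hlk.trans hkn)).2 m hf.2.2
    rwa [h.2] at h1

/-- Any point with finite dual value gives a feasible point of the master problem, to which the
first-order condition applies. -/
theorem le_model (hs : D.IsRun v rg κ s n) (hrg : 0 < rg) {k : ℕ} (hk1 : 1 ≤ k) (hkn : k ≤ n)
    {m : Fin I → Fin J → ℝ} {lam : Fin I → Fin M → ℝ} {f : ℝ} (h : D.IsDualValue v m lam f) :
    f ≤ (s.pt (k + 1)).model v + 2 * rg * inner ℝ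
      (dualVec (s.pt (k + 1)).m (s.pt (k + 1)).lam - dualVec (s.mbar k) (s.lambar k))
      (dualVec m lam - dualVec (s.pt (k + 1)).m (s.pt (k + 1)).lam) := by
  obtain ⟨hf, th, pe, hv, rfl⟩ := h
  exact (hs.master k hk1 hkn).model_le hrg (hs.isMasterFeasible_of_hasDualValues hk1 hkn hf hv)

/-- Comparing with the center itself bounds the step length by the predicted gain. -/
theorem center_le_model (hs : D.IsRun v rg κ s n) (hrg : 0 < rg) {k : ℕ} (hk1 : 1 ≤ k)
    (hkn : k ≤ n) {f : ℝ} (h : D.IsDualValue v (s.mbar k) (s.lambar k) f) :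
    f + 2 * rg * ‖dualVec (s.pt (k + 1)).m (s.pt (k + 1)).lam -
      dualVec (s.mbar k) (s.lambar k)‖ ^ 2 ≤ (s.pt (k + 1)).model v := by
  have h1 := hs.le_model hrg hk1 hkn h
  rw [← neg_sub (dualVec (s.pt (k + 1)).m _), inner_neg_right, real_inner_self_eq_norm_sq] at h1
  linarith

theorem descent_le {k : ℕ} (hk1 : 1 ≤ k) {f : ℝ}
    (h : D.IsDualValue v (s.mbar k) (s.lambar k) f) (hd : D.IsDescent v κ s (k + 1)) :
    (((1 - κ) * f + κ * (s.pt (k + 1)).model v : ℝ) : EReal) ≤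
      D.dualObjective v (s.pt (k + 1)).m (s.pt (k + 1)).lam := by
  rcases hd with hd | ⟨-, hd⟩
  · omega
  · rwa [Nat.add_sub_cancel, h.dualObjective_eq, ← EReal.coe_mul, ← EReal.coe_add] at hd

/-- As long as the centers are worse than a given point, their distance to it stays bounded. -/
theorem norm_center_sub_le (hs : D.IsRun v rg κ s n) (hrg : 0 < rg) (hκ₀ : 0 < κ) {f₁ f : ℝ}
    {m : Fin I → Fin J → ℝ} {lam : Fin I → Fin M → ℝ} (h : D.IsDualValue v m lam f)
    (h₁ : D.dualObjective v (s.pt 1).m (s.pt 1).lam = f₁) {k : ℕ} (hk1 : 1 ≤ k) (hkn : k ≤ n)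
    {g : ℝ} (hg : D.IsDualValue v (s.mbar k) (s.lambar k) g) (hgf : g < f) :
    rg * ‖dualVec (s.mbar k) (s.lambar k) - dualVec m lam‖ ^ 2 ≤
      rg * ‖dualVec (s.pt 1).m (s.pt 1).lam - dualVec m lam‖ ^ 2 + (g - f₁) / κ := by
  induction k, hk1 using Nat.le_induction generalizing g with
  | base =>
    have hc := hs.center_descent 1 le_rfl hkn (Or.inl rfl)
    have h2 := hg.dualObjective_eq
    rw [hc.1, hc.2, h₁, EReal.coe_eq_coe_iff] at h2
    rw [hc.1, hc.2, h2]
    simp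
  | succ k hk ih =>
    obtain ⟨g', hg'⟩ := hs.exists_isDualValue_center hk (by omega)
    by_cases hd : D.IsDescent v κ s (k + 1)
    · have hc := hs.center_descent _ (by omega) hkn hd
      have h2 := descent_le hk hg' hd
      rw [← hc.1, ← hc.2, hg.dualObjective_eq, EReal.coe_le_coe_iff] at h2
      have h3 := hs.center_le_model hrg hk (by omega) hg'
      have h4 := hs.le_model hrg hk (by omega) h
      rw [← hc.1, ← hc.2] at h3 h4
      have hn : 0 ≤ 2 * rg * ‖dualVec (s.mbar (k + 1)) (s.lambar (k + 1)) -
          dualVec (s.mbar k) (s.lambar k)‖ ^ 2 := by positivity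
      have h5 : g' ≤ g := by nlinarith
      have h6 := ih (by omega) hg' (h5.trans_lt hgf)
      -- The descent test: the actual gain is at least κ times the predicted one.
      have h7 : (s.pt (k + 1)).model v - g' ≤ (g - g') / κ := by
        rw [le_div_iff₀ hκ₀]
        linarith
      have h8 : (g - f₁) / κ = (g' - f₁) / κ + (g - g') / κ := by ring
      -- Expanding ‖z - o‖² about the new center, with z the comparison point, turns the inner
      -- product from `le_model` into the growth of the squared distance. `h7` bounds this growth,
      -- and `h8` telescopes.
      have h9 := norm_add_sq_real
        (dualVec (s.mbar (k + 1)) (s.lambar (k + 1)) - dualVec (s.mbar k) (s.lambar k))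
        (dualVec m lam - dualVec (s.mbar (k + 1)) (s.lambar (k + 1)))
      rw [sub_add_sub_cancel', norm_sub_rev (dualVec m lam), norm_sub_rev (dualVec m lam)] at h9
      nlinarith
    · have hc := hs.center_null _ (by omega) hkn hd
      rw [Nat.add_sub_cancel] at hc
      rw [hc.1, hc.2] at hg ⊢
      exact ih (by omega) hg hgf

/-- When the approximate stopping condition holds, the center is nearly as good as any given
point. -/
theorem center_near_optimal (hs : D.IsRun v rg κ s n) (hrg : 0 < rg) (hκ₀ : 0 < κ) {f₁ f : ℝ}
    {m : Fin I → Fin J → ℝ} {lam : Fin I → Fin M → ℝ} (h : D.IsDualValue v m lam f)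
    (h₁ : D.dualObjective v (s.pt 1).m (s.pt 1).lam = f₁) {k : ℕ} (hk1 : 1 ≤ k) (hkn : k ≤ n)
    {g : ℝ} (hg : D.IsDualValue v (s.mbar k) (s.lambar k) g) {B : ℝ}
    (hB : rg * ‖dualVec (s.pt 1).m (s.pt 1).lam - dualVec m lam‖ ^ 2 + (f - f₁) / κ ≤ B)
    {ε c : ℝ} (hε : 0 < ε) (htol : D.StopsAt v ε s k) (hc : 0 ≤ c) (hcB : 2 * ε * B ≤ c ^ 2) :
    f ≤ g + ε + c := by
  rcases le_or_gt f g with hfg | hgf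
  · linarith
  rw [StopsAt, hg.dualObjective_eq, ← EReal.coe_add, EReal.coe_le_coe_iff] at htol
  have h2 := hs.norm_center_sub_le hrg hκ₀ h h₁ hk1 hkn hg hgf
  have h3 := hs.center_le_model hrg hk1 hkn hg
  have h4 := hs.le_model hrg hk1 hkn h
  set z := dualVec m lam
  set w := dualVec (s.pt (k + 1)).m (s.pt (k + 1)).lam
  set o := dualVec (s.mbar k) (s.lambar k)
  have h5 : inner ℝ (w - o) (z - w) = inner ℝ (w - o) (z - o) - ‖w - o‖ ^ 2 := by
    rw [← real_inner_self_eq_norm_sq, ← inner_sub_right, sub_sub_sub_cancel_right]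
  have h6 := real_inner_le_norm (w - o) (z - o)
  rw [norm_sub_rev z o] at h6
  have h7 : (g - f₁) / κ ≤ (f - f₁) / κ := by gcongr
  have h8 : rg * ‖o - z‖ ^ 2 ≤ B := by linarith
  have h9 : 2 * rg * ‖w - o‖ ^ 2 ≤ ε := by linarith
  -- The square is twice the product of the quantities bounded in `h9` and `h8`, hence at most 2εB.
  have h10 : (2 * rg * (‖w - o‖ * ‖o - z‖)) ^ 2 ≤ c ^ 2 := by
    have h11 := mul_le_mul h9 h8 (by positivity) hε.le
    nlinarith
  have h12 : 2 * rg * (‖w - o‖ * ‖o - z‖) ≤ c := le_of_sq_le_sq h10 hc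
  rw [h5] at h4
  have h13 := mul_le_mul_of_nonneg_left h6 (by positivity : 0 ≤ 2 * rg)
  have h14 : 0 ≤ 2 * rg * ‖w - o‖ ^ 2 := by positivity
  linarith

/-- The center does not change until the next descent iteration. -/
theorem center_eq_of_forall_not_isDescent (hs : D.IsRun v rg κ s n) {k l : ℕ} (hkl : k ≤ l)
    (hln : l ≤ n) (h : ∀ j, k < j → j ≤ l → ¬ D.IsDescent v κ s j) :
    s.mbar l = s.mbar k ∧ s.lambar l = s.lambar k := by
  induction l, hkl using Nat.le_induction with
  | base => exact ⟨rfl, rfl⟩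
  | succ l hl ih =>
    have h1 := hs.center_null _ (by omega) hln (h _ (by omega) le_rfl)
    rw [Nat.add_sub_cancel] at h1
    rw [h1.1, h1.2]
    exact ih (by omega) fun j hj hjl => h j hj (by omega)

end IsRun

end TwoStageProblem

/-- The Lagrangian dual objective at `γ = ∑ᵢ mᵢ⁽ⁿ⁺¹⁾` tends to the optimal value as the tolerance
`ε` tends to `0`. Here `k` is the iteration at which the approximate stopping condition first holds
and `n + 1` is the first descent iteration after it. -/
theorem theorem5p11 {I J K L M N : ℕ} (D : TwoStageProblem I J K L M N)
    (hX : IsCompact D.feasible) (hne : D.feasible.Nonempty)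
    (v : Fin J → ℝ) (rg κ : ℝ) (hrg : 0 < rg) (hκ₀ : 0 < κ) (hκ₁ : κ < 1)
    (m₁ : Fin I → Fin J → ℝ) (lam₁ : Fin I → Fin M → ℝ) :
    ∃ p : ℝ, D.refValue v = (p : EReal) ∧
      ∀ δ : ℝ, 0 < δ → ∃ ε₀ : ℝ, 0 < ε₀ ∧ ∀ ε : ℝ, 0 < ε → ε < ε₀ →
        ∀ (s : BundleIterates I J M N) (k n : ℕ),
          (s.pt 1).m = m₁ → (s.pt 1).lam = lam₁ →
          D.IsRun v rg κ s n →
          IsLeast {j | 1 ≤ j ∧ D.StopsAt v ε s j} k →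
          IsLeast {j | k < j ∧ D.IsDescent v κ s j} (n + 1) →
          0 ≤ ∑ i, (s.pt (n + 1)).m i ∧
            ∃ d : ℝ, D.lagrangeDual v (∑ i, (s.pt (n + 1)).m i) = (d : EReal) ∧ |d - p| < δ := by
  obtain ⟨p, hp⟩ := D.exists_refValue_eq_coe hX hne v
  refine ⟨p, hp, fun δ hδ => ?_⟩
  -- Error budget: δ/4 each for the duality gap, for ε, and for the term of order √ε, leaving δ/4 to
  -- spare.
  obtain ⟨m, lam, th, pe, hf, hv, hle⟩ := D.exists_hasDualValues_ge hX hne v (p - δ / 4)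
    (by rw [hp, EReal.coe_lt_coe_iff]; linarith)
  set f := ∑ i, th i - pe - ∑ i, m i ⬝ᵥ v with hfdef
  have hz : D.IsDualValue v m lam f := ⟨hf, th, pe, hv, rfl⟩
  -- The threshold must be fixed before the run, while finiteness of the initial dual value is only
  -- known from the run; hence `toReal`.
  set B₀ := rg * ‖dualVec m₁ lam₁ - dualVec m lam‖ ^ 2 +
    (f - (D.dualObjective v m₁ lam₁).toReal) / κ with hB₀
  set B := |B₀| + 1 with hB
  have hBpos : 0 < B := by positivity
  refine ⟨min (δ / 4) ((δ / 4) ^ 2 / (2 * B)), by positivity, ?_⟩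
  rintro ε hε hεlt s k n rfl rfl hs hk hn
  obtain ⟨hε1, hε2⟩ := lt_min_iff.mp hεlt
  obtain ⟨⟨hk1, htol⟩, -⟩ := hk
  obtain ⟨⟨hkn, hd⟩, hnmin⟩ := hn
  have hkn' : k ≤ n := Nat.lt_succ_iff.mp hkn
  have hfeas := hs.isDualFeasible_pt (l := n + 1) (by omega) le_rfl
  obtain ⟨f₁, hf₁⟩ := hs.exists_isDualValue_pt le_rfl (hk1.trans hkn')
  have h₁ := hf₁.dualObjective_eq
  obtain ⟨g, hg⟩ := hs.exists_isDualValue_center hk1 hkn'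
  have hnear := hs.center_near_optimal hrg hκ₀ hz h₁ hk1 hkn' hg (B := B)
    (by rw [h₁, EReal.toReal_coe] at hB₀; rw [← hB₀]; linarith [le_abs_self B₀])
    hε htol (c := δ / 4) (by positivity)
    (by rw [lt_div_iff₀ (by positivity)] at hε2; linarith)
  have hcn := hs.center_eq_of_forall_not_isDescent hkn' le_rfl fun j hj hjn hdj => by
    have := hnmin ⟨hj, hdj⟩
    omega
  rw [← hcn.1, ← hcn.2] at hg
  have hmodel := hs.center_le_model hrg (hk1.trans hkn') le_rfl hg
  have hdesc := TwoStageProblem.IsRun.descent_le (hk1.trans hkn') hg hd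
  have hgle : g ≤ (1 - κ) * g + κ * (s.pt (n + 1)).model v := by
    have h1 : 0 ≤ 2 * rg * ‖dualVec (s.pt (n + 1)).m (s.pt (n + 1)).lam -
        dualVec (s.mbar n) (s.lambar n)‖ ^ 2 := by positivity
    have h2 : g ≤ (s.pt (n + 1)).model v := by linarith
    have h3 := mul_le_mul_of_nonneg_left h2 hκ₀.le
    linarith
  -- The record of the run does not include the subproblems at n + 1, so the descent test supplies
  -- the lower bound there. Finiteness of the Lagrangian dual value then follows from the two-sided
  -- bound.
  have hlow : (g : EReal) ≤ D.lagrangeDual v (∑ i, (s.pt (n + 1)).m i) :=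
    ((EReal.coe_le_coe_iff.mpr hgle).trans hdesc).trans (D.dualObjective_le_lagrangeDual v hfeas)
  have hup : D.lagrangeDual v (∑ i, (s.pt (n + 1)).m i) ≤ p :=
    hp ▸ D.lagrangeDual_le_refValue v _
  refine ⟨Finset.sum_nonneg fun i _ => hfeas.2.2 i, ?_⟩
  obtain ⟨d, hd⟩ : ∃ d : ℝ, D.lagrangeDual v (∑ i, (s.pt (n + 1)).m i) = d :=
    ⟨_, (EReal.coe_toReal (ne_top_of_le_ne_top (EReal.coe_ne_top _) hup)
      (ne_bot_of_le_ne_bot (EReal.coe_ne_bot _) hlow)).symm⟩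
  refine ⟨d, hd, ?_⟩
  rw [hd, EReal.coe_le_coe_iff] at hlow hup
  rw [abs_lt]
  constructor <;> linarith
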